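/- For $n,d\ge 1$ let $F_{n,d}$ be the real vector space of forms (homogeneous polynomials) of degree $d$ in $\mathbb R[x_1,\dots,x_n]$, together with $0$, let $F^k_{n,d}\subset F_{n,d}$ be the set of those with at most $k$ terms (at most $k$ monomials with non-zero coefficient), and let $$\Sigma^k_{n,2d}=\Bigl\{\sum_{j=1}^m h_j^2 \;:\; m\in\mathbb N,\ h_j\in F^k_{n,d}\Bigr\}.$$ Put $N(n,d)=\binom{n+d-1}{n-1}$ and let $2\le k\le N(n,d)$. Then: (a) $\Sigma^{k-1}_{n,2d}\subsetneq\Sigma^k_{n,2d}$. (b) If $h\in F_{n,d}$ has exactly $k$ terms and is either indefinite (it takes both positive and negative values on $\mathbb R^n$) and irreducible in $\mathbb R[x_1,\dots,x_n]$, or a product of real linear forms, then $h^2\in\Sigma^k_{n,2d}\setminus\Sigma^{k-1}_{n,2d}$. (c) Forms as in (b) exist: if $n=2$, there is a product of real linear forms in $F_{2,d}$ with exactly $k$ terms; if $n\ge 3$, there is an indefinite irreducible form in $F_{n,d}$ with exactly $k$ terms. -/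

import Mathlib

namespace SosTerms

noncomputable section

/-- The number of monomials of degree `d` in `n ≥ 1` variables. -/
def N (n d : ℕ) : ℕ := Nat.choose (n + d - 1) (n - 1)

/-- The real vector space of forms of degree `d` in `n` variables (including the zero form). -/
def F (n d : ℕ) : Submodule ℝ (MvPolynomial (Fin n) ℝ) :=
  MvPolynomial.homogeneousSubmodule (Fin n) ℝ d

/-- The forms of degree `d` in `n` variables with at most `k` terms. -/
def FTerms (n d k : ℕ) : Set (MvPolynomial (Fin n) ℝ) :=
  {p | p ∈ F n d ∧ p.support.card ≤ k}

/-- The cone of finite sums of squares of forms of degree `d` in `n` variables, each with at most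
`k` terms; its elements are forms of degree `2 * d`. -/
def Sigma (n d k : ℕ) : Set (MvPolynomial (Fin n) ℝ) :=
  {f | ∃ (m : ℕ) (h : Fin m → MvPolynomial (Fin n) ℝ),
    (∀ j, h j ∈ FTerms n d k) ∧ f = ∑ j, h j ^ 2}

/-- A real polynomial is indefinite if it takes both positive and negative values. -/
def Indefinite {n : ℕ} (h : MvPolynomial (Fin n) ℝ) : Prop :=
  (∃ x : Fin n → ℝ, 0 < MvPolynomial.eval x h) ∧ ∃ y : Fin n → ℝ, MvPolynomial.eval y h < 0

/-- A finite product of real linear forms. -/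
def IsProductOfLinearForms {n : ℕ} (h : MvPolynomial (Fin n) ℝ) : Prop :=
  ∃ (m : ℕ) (l : Fin m → MvPolynomial (Fin n) ℝ), (∀ i, l i ∈ F n 1) ∧ h = ∏ i, l i

end

end SosTerms

/-!
An indefinite irreducible real polynomial `h` divides every polynomial `p` vanishing at its real
zeros: on every line parallel and close to one joining a point with `h > 0` to a point with `h < 0`,
`h` has a real zero, so that the resultant of `h` and `p` along these lines vanishes on an open set
of base points, hence identically.
Hence if `h ^ 2` is a sum of squares, `h` divides each summand, and the same follows for products of
linear forms by cancelling one factor at a time. A form dividing a form of its own degree has the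
same terms, so the summands cannot have fewer terms than `h`.

For `n ≥ 3`, an indefinite irreducible form with prescribed exponents is obtained from an integral
one that is congruent modulo `2` to the irreducible binomial `X₀ ^ (d - 1) * X₁ + X₂ ^ d`.
Irreducibility is lifted to `ℝ` by Gauss's lemma over a valuation ring of `ℝ` in which `2` is not a
unit.
-/

namespace SosTerms

open MvPolynomial Topology

universe u

section SqReal

variable {A : Type*} [CommRing A]

/-- An element `a` is *square-real* if, whenever `a ^ 2` divides a sum of squares, `a` divides every
summand. For a prime `a` this says that the ideal `(a)` is real; unlike reality of `(a)`, the
property is inherited by products, including those with repeated factors. -/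
def IsSqReal (a : A) : Prop :=
  ∀ ⦃m : ℕ⦄ (g : Fin m → A), a ^ 2 ∣ ∑ j, g j ^ 2 → ∀ j, a ∣ g j

lemma isSqReal_one : IsSqReal (1 : A) := fun _ _ _ _ => one_dvd _

lemma IsSqReal.mul [IsDomain A] {a b : A} (ha : IsSqReal a) (hb : IsSqReal b) :
    IsSqReal (a * b) := by
  intro m g hg
  rw [mul_pow] at hg
  choose g' hg' using ha g (dvd_of_mul_right_dvd hg)
  obtain rfl | ha0 := eq_or_ne a 0
  · simpa using hg'
  simp only [hg', mul_pow, ← Finset.mul_sum] at hg ⊢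
  exact fun j => mul_dvd_mul_left a (hb g' ((mul_dvd_mul_iff_left (pow_ne_zero 2 ha0)).1 hg) j)

lemma isSqReal_prod [IsDomain A] {ι : Type*} {s : Finset ι} {a : ι → A}
    (ha : ∀ i ∈ s, IsSqReal (a i)) : IsSqReal (∏ i ∈ s, a i) :=
  Finset.prod_induction a IsSqReal (fun _ _ => IsSqReal.mul) isSqReal_one ha

lemma isSqReal_of_forall_dvd {σ : Type*} {h : MvPolynomial σ ℝ}
    (hdvd : ∀ p : MvPolynomial σ ℝ, (∀ x, eval x h = 0 → eval x p = 0) → h ∣ p) :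
    IsSqReal h := by
  rintro m g ⟨q, hq⟩ j
  refine hdvd _ fun x hx => ?_
  have hsum : ∑ i, eval x (g i) ^ 2 = 0 := by
    simpa [hx] using congrArg (eval x) hq
  have hterm := (Finset.sum_eq_zero_iff_of_nonneg fun i _ => sq_nonneg (eval x (g i))).1 hsum
  exact eq_zero_of_pow_eq_zero (hterm j (Finset.mem_univ j))

end SqReal

section LineShear

variable {σ R : Type*} [CommRing R]

/-- The endomorphism of `R[X][T]` that fixes `T` and sends `X i` to `X i + v i * T`. On a polynomial
`p` in the variables `X` alone it gives the restriction of `p` to the lines of direction `v`, with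
parameter `T`. -/
noncomputable def lineShearHom (v : σ → R) :
    Polynomial (MvPolynomial σ R) →ₐ[R] Polynomial (MvPolynomial σ R) :=
  Polynomial.eval₂AlgHom (aeval fun i => Polynomial.C (X i) + Polynomial.C (C (v i)) * Polynomial.X)
    Polynomial.X fun _ => Commute.all _ _

lemma lineShearHom_C_X (v : σ → R) (i : σ) : lineShearHom v (Polynomial.C (X i)) =
    Polynomial.C (X i) + Polynomial.C (C (v i)) * Polynomial.X := by
  simp [lineShearHom]

lemma lineShearHom_C_C (v : σ → R) (a : R) :
    lineShearHom v (Polynomial.C (C a)) = Polynomial.C (C a) :=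
  (lineShearHom v).commutes a

lemma lineShearHom_X (v : σ → R) : lineShearHom v Polynomial.X = Polynomial.X := by
  simp [lineShearHom]

lemma lineShearHom_comp_neg (v : σ → R) :
    (lineShearHom v).comp (lineShearHom (-v)) = AlgHom.id R _ := by
  refine Polynomial.algHom_ext' (MvPolynomial.algHom_ext fun i => ?_) ?_
  · simp only [AlgHom.coe_comp, AlgHom.coe_id, Function.comp_apply, id_eq,
      Polynomial.CAlgHom_apply, lineShearHom_C_X, lineShearHom_C_C, lineShearHom_X, map_add,
      map_mul, map_neg, Pi.neg_apply]
    ring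
  · simp [lineShearHom_X]

/-- The shear `lineShearHom v` as an automorphism; its inverse is the shear along `-v`. -/
noncomputable def lineShear (v : σ → R) :
    Polynomial (MvPolynomial σ R) ≃ₐ[R] Polynomial (MvPolynomial σ R) :=
  AlgEquiv.ofAlgHom (lineShearHom v) (lineShearHom (-v)) (lineShearHom_comp_neg v)
    (by simpa using lineShearHom_comp_neg (-v))

lemma eval₂_lineShear_C (v u : σ → R) (s : R) (p : MvPolynomial σ R) :
    Polynomial.eval₂ (eval u) s (lineShear v (Polynomial.C p)) = eval (u + s • v) p := by
  change Polynomial.eval₂ (eval u) s (lineShearHom v (Polynomial.C p)) = _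
  induction p using MvPolynomial.induction_on with
  | C a => simp [lineShearHom_C_C]
  | add p q hp hq => simp [hp, hq]
  | mul_X p i hp => simp [hp, lineShearHom_C_X, Polynomial.eval₂_mul, mul_comm s]

lemma irreducible_lineShear_C [IsDomain R] [UniqueFactorizationMonoid R] (v : σ → R)
    {h : MvPolynomial σ R} (hirr : Irreducible h) : Irreducible (lineShear v (Polynomial.C h)) :=
  (MulEquiv.irreducible_iff (lineShear v)).2 (Polynomial.prime_C_iff.2 hirr.prime).irreducible

lemma lineShear_C_dvd_lineShear_C {v : σ → R} {h p : MvPolynomial σ R} :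
    lineShear v (Polynomial.C h) ∣ lineShear v (Polynomial.C p) ↔ h ∣ p := by
  rw [map_dvd_iff, Polynomial.C_dvd_iff_dvd_coeff]
  refine ⟨fun hdvd => by simpa using hdvd 0, fun hdvd i => ?_⟩
  rw [Polynomial.coeff_C]
  split_ifs
  exacts [hdvd, dvd_zero h]

lemma natDegree_lineShear_C_ne_zero {x y : σ → R} {h : MvPolynomial σ R}
    (hxy : eval x h ≠ eval y h) : (lineShear (y - x) (Polynomial.C h)).natDegree ≠ 0 := by
  intro hdeg
  have hx := eval₂_lineShear_C (y - x) x 0 h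
  have hy := eval₂_lineShear_C (y - x) x 1 h
  rw [Polynomial.eq_C_of_natDegree_eq_zero hdeg, Polynomial.eval₂_C] at hx hy
  exact hxy (by simpa using hx.symm.trans hy)

end LineShear

section SignChange

lemma resultant_ne_zero_of_irreducible_of_not_dvd {A : Type*} [CommRing A] [IsDomain A]
    [UniqueFactorizationMonoid A] {f g : Polynomial A} (hf : Irreducible f)
    (hdeg : f.natDegree ≠ 0) (hfg : ¬ f ∣ g) : f.resultant g ≠ 0 := by
  have hprim := hf.isPrimitive hdeg
  let K := FractionRing A
  have hinj : Function.Injective (algebraMap A K) := IsFractionRing.injective A K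
  have hfK : Irreducible (f.map (algebraMap A K)) :=
    hprim.irreducible_iff_irreducible_map_fraction_map.1 hf
  have hcop : IsCoprime (f.map (algebraMap A K)) (g.map (algebraMap A K)) :=
    hfK.coprime_iff_not_dvd.2 fun h => hfg (hprim.dvd_of_fraction_map_dvd_fraction_map h)
  intro hres
  have hresK : (f.map (algebraMap A K)).resultant (g.map (algebraMap A K)) = 0 := by
    rw [Polynomial.resultant_map_map, Polynomial.natDegree_map_eq_of_injective hinj,
      Polynomial.natDegree_map_eq_of_injective hinj, hres, map_zero]
  exact (Polynomial.resultant_eq_zero_iff.1 hresK).2 hcop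

lemma eq_zero_of_eventually_eval_eq_zero {σ : Type*} {p : MvPolynomial σ ℝ} {x : σ → ℝ}
    (hp : ∀ᶠ u in 𝓝 x, eval u p = 0) : p = 0 := by
  rw [nhds_pi, Filter.Eventually, Filter.mem_pi] at hp
  obtain ⟨I, -, t, ht, hsub⟩ := hp
  refine MvPolynomial.funext_set t (fun i => infinite_of_mem_nhds (x i) (ht i)) fun u hu => ?_
  simpa using hsub fun i _ => hu i (Set.mem_univ i)

variable {σ : Type*} {h p : MvPolynomial σ ℝ}

lemma exists_eval_add_smul_eq_zero {u v : σ → ℝ} (hpos : 0 < eval u h)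
    (hneg : eval (u + v) h < 0) : ∃ s : ℝ, eval (u + s • v) h = 0 := by
  have hcont : Continuous fun s : ℝ => eval (u + s • v) h :=
    (MvPolynomial.continuous_eval h).comp (by fun_prop)
  exact mem_range_of_exists_le_of_exists_ge hcont ⟨1, by simpa using hneg.le⟩
    ⟨0, by simpa using hpos.le⟩

lemma eval_resultant_lineShear_eq_zero {u v : σ → ℝ} (hpos : 0 < eval u h)
    (hneg : eval (u + v) h < 0) (hz : ∀ x, eval x h = 0 → eval x p = 0)
    (hdeg : (lineShear v (Polynomial.C h)).natDegree ≠ 0) :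
    eval u ((lineShear v (Polynomial.C h)).resultant (lineShear v (Polynomial.C p))) = 0 := by
  obtain ⟨a, b, -, -, hab⟩ := Polynomial.exists_mul_add_mul_eq_C_resultant
    (lineShear v (Polynomial.C h)) (lineShear v (Polynomial.C p)) le_rfl le_rfl (.inl hdeg)
  obtain ⟨s, hs⟩ := exists_eval_add_smul_eq_zero hpos hneg
  have hroot := congrArg (Polynomial.eval₂ (eval u) s) hab
  simpa [Polynomial.eval₂_mul, eval₂_lineShear_C, hs, hz _ hs] using hroot.symm

theorem dvd_of_forall_eval_eq_zero (hirr : Irreducible h) {x y : σ → ℝ} (hx : 0 < eval x h)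
    (hy : eval y h < 0) (hz : ∀ x, eval x h = 0 → eval x p = 0) : h ∣ p := by
  by_contra hdvd
  set v := y - x
  have hdeg : (lineShear v (Polynomial.C h)).natDegree ≠ 0 :=
    natDegree_lineShear_C_ne_zero (hy.trans hx).ne'
  have hpos : ∀ᶠ u in 𝓝 x, 0 < eval u h :=
    (MvPolynomial.continuous_eval h).continuousAt.eventually_const_lt hx
  have hneg : ∀ᶠ u in 𝓝 x, eval (u + v) h < 0 := by
    have hcont : Continuous fun u => eval (u + v) h :=
      (MvPolynomial.continuous_eval h).comp (by fun_prop)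
    exact hcont.continuousAt.eventually_lt_const (by simpa [v] using hy)
  refine resultant_ne_zero_of_irreducible_of_not_dvd (irreducible_lineShear_C v hirr) hdeg
    (lineShear_C_dvd_lineShear_C.not.2 hdvd) (eq_zero_of_eventually_eval_eq_zero (x := x) ?_)
  filter_upwards [hpos, hneg] with u hu huv
  exact eval_resultant_lineShear_eq_zero hu huv hz hdeg

end SignChange

section Forms

lemma eval_smul_of_isHomogeneous {σ R : Type*} [CommSemiring R] {p : MvPolynomial σ R} {d : ℕ}
    (hp : p.IsHomogeneous d) (c : R) (x : σ → R) : eval (c • x) p = c ^ d * eval x p := by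
  rw [eval_eq, eval_eq, Finset.mul_sum]
  refine Finset.sum_congr rfl fun m hm => ?_
  have hdeg : ∑ i ∈ m.support, m i = d := (hp.degree_eq_sum_deg_support hm).symm
  simp only [Pi.smul_apply, smul_eq_mul, mul_pow, Finset.prod_mul_distrib]
  rw [Finset.prod_pow_eq_pow_sum, hdeg, mul_left_comm]

variable {n d k : ℕ}

lemma Indefinite.isSqReal {h : MvPolynomial (Fin n) ℝ} (hind : Indefinite h)
    (hirr : Irreducible h) : IsSqReal h := by
  obtain ⟨⟨x, hx⟩, y, hy⟩ := hind
  exact isSqReal_of_forall_dvd fun _ => dvd_of_forall_eval_eq_zero hirr hx hy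

lemma indefinite_of_odd {h : MvPolynomial (Fin n) ℝ} (hh : h ∈ F n d) (hd : Odd d) (h0 : h ≠ 0) :
    Indefinite h := by
  obtain ⟨x, hx⟩ : ∃ x, eval x h ≠ 0 := by
    by_contra! hzero
    exact h0 (MvPolynomial.funext fun x => by simpa using hzero x)
  have hneg : eval (-x) h = -eval x h := by
    simpa [hd.neg_one_pow] using eval_smul_of_isHomogeneous hh (-1) x
  rcases hx.lt_or_gt with hx | hx
  · exact ⟨⟨-x, by linarith⟩, x, hx⟩
  · exact ⟨⟨x, hx⟩, -x, by linarith⟩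

lemma irreducible_of_isHomogeneous_one {σ K : Type*} [Field K] {l : MvPolynomial σ K}
    (hl : l.IsHomogeneous 1) (h0 : l ≠ 0) : Irreducible l := by
  refine irreducible_of_totalDegree_eq_one (hl.totalDegree h0) fun a ha => ?_
  obtain ⟨m, hm⟩ := MvPolynomial.ne_zero_iff.1 h0
  exact isUnit_iff_ne_zero.2 fun ha0 => hm (by simpa [ha0] using ha m)

lemma isSqReal_of_linear {l : MvPolynomial (Fin n) ℝ} (hl : l ∈ F n 1) : IsSqReal l := by
  obtain rfl | h0 := eq_or_ne l 0
  · exact isSqReal_of_forall_dvd fun p hp =>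
      zero_dvd_iff.2 (MvPolynomial.funext fun x => by simpa using hp x (map_zero _))
  · exact (indefinite_of_odd hl odd_one h0).isSqReal (irreducible_of_isHomogeneous_one hl h0)

lemma IsProductOfLinearForms.isSqReal {h : MvPolynomial (Fin n) ℝ}
    (hh : IsProductOfLinearForms h) : IsSqReal h := by
  obtain ⟨m, l, hl, rfl⟩ := hh
  exact isSqReal_prod fun i _ => isSqReal_of_linear (hl i)

lemma support_eq_of_dvd {σ R : Type*} [CommRing R] [IsDomain R] {h g : MvPolynomial σ R}
    (hh : h.IsHomogeneous d) (hg : g.IsHomogeneous d) (hg0 : g ≠ 0) (hdvd : h ∣ g) :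
    g.support = h.support := by
  obtain ⟨q, rfl⟩ := hdvd
  obtain ⟨hh0, hq0⟩ := mul_ne_zero_iff.1 hg0
  have hdeg := totalDegree_mul_of_isDomain hh0 hq0
  rw [hg.totalDegree hg0, hh.totalDegree hh0] at hdeg
  obtain ⟨c, rfl⟩ : ∃ c, q = C c := ⟨_, totalDegree_eq_zero_iff_eq_C.1 (by omega)⟩
  have hc : c ≠ 0 := by simpa using hq0
  ext m
  simp [mul_comm h, hc]

lemma sigma_mono {k' : ℕ} (hkk : k ≤ k') : Sigma n d k ⊆ Sigma n d k' := by
  rintro _ ⟨m, g, hg, rfl⟩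
  exact ⟨m, g, fun j => ⟨(hg j).1, (hg j).2.trans hkk⟩, rfl⟩

lemma sq_mem_sigma {h : MvPolynomial (Fin n) ℝ} (hh : h ∈ FTerms n d k) :
    h ^ 2 ∈ Sigma n d k :=
  ⟨1, fun _ => h, fun _ => hh, by simp⟩

theorem IsSqReal.sq_notMem_sigma {h : MvPolynomial (Fin n) ℝ} (hreal : IsSqReal h)
    (hh : h ∈ F n d) (hk : k < h.support.card) : h ^ 2 ∉ Sigma n d k := by
  rintro ⟨m, g, hg, hsum⟩
  have hzero : ∀ j, g j = 0 := by
    intro j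
    by_contra hj
    have hsupp := support_eq_of_dvd hh (hg j).1 hj (hreal g (dvd_of_eq hsum) j)
    exact hk.not_ge (hsupp ▸ (hg j).2)
  have h0 : h = 0 := eq_zero_of_pow_eq_zero (hsum.trans (by simp [hzero]))
  simp [h0] at hk

theorem sq_mem_sigma_diff (hk : k ≠ 0) {h : MvPolynomial (Fin n) ℝ} (hh : h ∈ F n d)
    (hcard : h.support.card = k)
    (hcase : (Indefinite h ∧ Irreducible h) ∨ IsProductOfLinearForms h) :
    h ^ 2 ∈ Sigma n d k \ Sigma n d (k - 1) := by
  have hreal : IsSqReal h :=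
    hcase.elim (fun hind => hind.1.isSqReal hind.2) IsProductOfLinearForms.isSqReal
  exact ⟨sq_mem_sigma ⟨hh, hcard.le⟩, hreal.sq_notMem_sigma hh (by omega)⟩

end Forms

section Reduction

lemma isUnit_iff_totalDegree_eq_zero {σ K : Type*} [Field K] {p : MvPolynomial σ K} (hp : p ≠ 0) :
    IsUnit p ↔ p.totalDegree = 0 := by
  rw [isUnit_iff_totalDegree_of_isReduced, and_iff_right_iff_imp]
  intro hdeg
  rw [totalDegree_eq_zero_iff_eq_C] at hdeg
  exact isUnit_iff_ne_zero.2 fun h0 => hp (by rw [hdeg, h0, C_0])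

lemma totalDegree_map_eq_of_injective {σ R S : Type*} [CommSemiring R] [CommSemiring S]
    {φ : R →+* S} (hφ : Function.Injective φ) (p : MvPolynomial σ R) :
    (map φ p).totalDegree = p.totalDegree := by
  rw [totalDegree, totalDegree, support_map_of_injective p hφ]

lemma totalDegree_map_le {σ R S : Type*} [CommSemiring R] [CommSemiring S] (φ : R →+* S)
    (p : MvPolynomial σ R) : (map φ p).totalDegree ≤ p.totalDegree :=
  Finset.sup_mono (support_map_subset _ _)

lemma totalDegree_map_left_eq {σ R S : Type*} [CommRing R] [IsDomain R] [CommRing S] [IsDomain S]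
    {φ : R →+* S} {p q : MvPolynomial σ R} (hpq : map φ (p * q) ≠ 0)
    (hdeg : (map φ (p * q)).totalDegree = (p * q).totalDegree) :
    (map φ p).totalDegree = p.totalDegree := by
  have hpq0 : p * q ≠ 0 := fun h => hpq (by rw [h, map_zero])
  rw [map_mul] at hpq hdeg
  rw [totalDegree_mul_of_isDomain (left_ne_zero_of_mul hpq) (right_ne_zero_of_mul hpq),
    totalDegree_mul_of_isDomain (left_ne_zero_of_mul hpq0) (right_ne_zero_of_mul hpq0)] at hdeg
  have hp := totalDegree_map_le φ p
  have hq := totalDegree_map_le φ q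
  omega

variable {σ : Type*} {K : Type u} [Field K] {V : ValuationSubring K}

variable (V) in
lemma exists_primitive_multiple {p : MvPolynomial σ K} (hp : p ≠ 0) :
    ∃ (a : K) (p' : MvPolynomial σ V), a ≠ 0 ∧ p = C a * map (algebraMap V K) p' ∧
      map (IsLocalRing.residue V) p' ≠ 0 := by
  obtain ⟨m, hm, hmax⟩ := p.support.exists_max_image (fun i => V.valuation (coeff i p))
    (support_nonempty.2 hp)
  have ha : coeff m p ≠ 0 := mem_support_iff.1 hm
  have hrange : C (coeff m p)⁻¹ * p ∈ (map (algebraMap V K) : MvPolynomial σ V →+* _).range := by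
    refine mem_range_map_iff_coeffs_subset.2 fun c hc => ?_
    obtain ⟨i, hi, rfl⟩ := mem_coeffs_iff.1 hc
    have hi' : i ∈ p.support := by simpa [ha] using hi
    have hle : V.valuation ((coeff m p)⁻¹ * coeff i p) ≤ 1 := by
      rw [inv_mul_eq_div, map_div₀]
      exact div_le_one_of_le₀ (hmax i hi') zero_le
    exact ⟨⟨_, (V.valuation_le_one_iff _).1 hle⟩, (coeff_C_mul _ _ _).symm⟩
  obtain ⟨p', hp'⟩ := hrange
  refine ⟨coeff m p, p', ha, ?_, fun hres => ?_⟩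
  · rw [hp', ← mul_assoc, ← C_mul, mul_inv_cancel₀ ha, C_1, one_mul]
  · have hcoeff : coeff m p' = 1 := by
      apply IsFractionRing.injective V K
      rw [← coeff_map, hp', coeff_C_mul, inv_mul_cancel₀ ha, map_one]
    have hzero := congrArg (coeff m) hres
    rw [coeff_map, hcoeff, map_one, coeff_zero] at hzero
    exact one_ne_zero hzero

lemma mem_of_C_mul_map_eq {a : K} {f g : MvPolynomial σ V}
    (hg : map (IsLocalRing.residue V) g ≠ 0)
    (h : C a * map (algebraMap V K) g = map (algebraMap V K) f) : a ∈ V := by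
  obtain ⟨m, hm⟩ := MvPolynomial.ne_zero_iff.1 hg
  obtain ⟨u, hu⟩ : IsUnit (coeff m g) := by
    rwa [coeff_map, IsLocalRing.residue_ne_zero_iff_isUnit] at hm
  have hcoeff : a * algebraMap V K u = algebraMap V K (coeff m f) := by
    rw [hu, ← coeff_map, ← coeff_map, ← h, coeff_C_mul]
  have ha : a = algebraMap V K (coeff m f * ↑u⁻¹) := by
    rw [map_mul, ← hcoeff, mul_assoc, ← map_mul, Units.mul_inv, map_one, mul_one]
  rw [ha]
  exact (coeff m f * (↑u⁻¹ : V)).2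

lemma exists_eq_mul_of_map_eq_mul {f : MvPolynomial σ V} {p q : MvPolynomial σ K} (hf : f ≠ 0)
    (h : map (algebraMap V K) f = p * q) :
    ∃ p' q' : MvPolynomial σ V, f = p' * q' ∧ Associated (map (algebraMap V K) p') p ∧
      Associated (map (algebraMap V K) q') q := by
  have hinj : Function.Injective (map (algebraMap V K) : MvPolynomial σ V → _) :=
    map_injective _ (IsFractionRing.injective V K)
  have hpq : p * q ≠ 0 := h ▸ (map_ne_zero_iff _ hinj).2 hf
  obtain ⟨a, p₁, ha, rfl, hp₁⟩ := exists_primitive_multiple V (left_ne_zero_of_mul hpq)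
  obtain ⟨b, q₁, hb, rfl, hq₁⟩ := exists_primitive_multiple V (right_ne_zero_of_mul hpq)
  have hC : ∀ c : K, c ≠ 0 → IsUnit (C c : MvPolynomial σ K) := fun c hc =>
    (isUnit_iff_ne_zero.2 hc).map C
  have hf' : C (a * b) * map (algebraMap V K) (p₁ * q₁) = map (algebraMap V K) f := by
    rw [h, C_mul, map_mul]
    ring
  have hab : a * b ∈ V := mem_of_C_mul_map_eq (by simpa using ⟨hp₁, hq₁⟩) hf'
  have hmapC : map (algebraMap V K) (C ⟨a * b, hab⟩ : MvPolynomial σ V) = C (a * b) := map_C _ _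
  refine ⟨C ⟨a * b, hab⟩ * p₁, q₁, hinj ?_, ?_, ?_⟩
  · rw [← hf', mul_assoc, map_mul _ (C _), hmapC]
  · rw [map_mul, hmapC]
    exact (associated_unit_mul_left _ _ (hC _ (mul_ne_zero ha hb))).trans
      (associated_unit_mul_right _ _ (hC a ha))
  · exact associated_unit_mul_right _ _ (hC b hb)

theorem irreducible_map_of_irreducible_residue {f : MvPolynomial σ V}
    (hf : Irreducible (map (IsLocalRing.residue V) f))
    (hdeg : (map (IsLocalRing.residue V) f).totalDegree = f.totalDegree) :
    Irreducible (map (algebraMap V K) f) := by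
  have hinj := IsFractionRing.injective V K
  have hisUnit : ∀ p q : MvPolynomial σ V, f = p * q → IsUnit (map (IsLocalRing.residue V) p) →
      IsUnit (map (algebraMap V K) p) := by
    rintro p q rfl hu
    have hp0 : map (algebraMap V K) p ≠ 0 :=
      (map_ne_zero_iff _ (map_injective _ hinj)).2 fun h => hu.ne_zero (by rw [h, map_zero])
    rwa [isUnit_iff_totalDegree_eq_zero hp0, totalDegree_map_eq_of_injective hinj,
      ← totalDegree_map_left_eq hf.ne_zero hdeg, ← isUnit_iff_totalDegree_eq_zero hu.ne_zero]
  have hf0 : f ≠ 0 := fun h => hf.ne_zero (by rw [h, map_zero])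
  refine ⟨fun hu => hf.not_isUnit ?_, fun p q hpq => ?_⟩
  · rwa [isUnit_iff_totalDegree_eq_zero hf.ne_zero, hdeg, ← totalDegree_map_eq_of_injective hinj,
      ← isUnit_iff_totalDegree_eq_zero hu.ne_zero]
  · obtain ⟨p', q', rfl, hp, hq⟩ := exists_eq_mul_of_map_eq_mul hf0 hpq
    rw [← hp.isUnit_iff, ← hq.isUnit_iff]
    rw [map_mul] at hf
    exact (hf.isUnit_or_isUnit rfl).imp (hisUnit p' q' rfl) (hisUnit q' p' (mul_comm _ _))

variable (K) in
lemma exists_valuationSubring_natCast_mem_nonunits [CharZero K] {p : ℕ} (hp : p.Prime) :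
    ∃ V : ValuationSubring K, (p : K) ∈ V.nonunits := by
  let A := (Int.castRingHom K).range
  have hspan : Ideal.span {(p : A)} ≠ ⊤ := by
    rw [Ne, Ideal.span_singleton_eq_top]
    intro hu
    obtain ⟨⟨_, z, rfl⟩, hz⟩ := hu.exists_right_inv
    have hzK : (p : K) * z = 1 := by simpa using congrArg Subtype.val hz
    have hzZ : (p : ℤ) * z = 1 := by exact_mod_cast hzK
    exact hp.not_isUnit (Int.ofNat_isUnit.1 (.of_mul_eq_one z hzZ))
  obtain ⟨V, -, hV⟩ := Ideal.image_subset_nonunits_valuationSubring _ hspan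
  exact ⟨V, hV ⟨p, Ideal.mem_span_singleton_self _, by simp⟩⟩

theorem irreducible_map_intCast [CharZero K] {p d : ℕ} (hp : p.Prime)
    {f : MvPolynomial σ ℤ} (hf : f.IsHomogeneous d)
    (hirr : ∀ (k : Type u) [Field k] [CharP k p], Irreducible (map (Int.castRingHom k) f)) :
    Irreducible (map (Int.castRingHom K) f) := by
  obtain ⟨V, hV⟩ := exists_valuationSubring_natCast_mem_nonunits K hp
  have hchar : CharP (IsLocalRing.ResidueField V) p := by
    refine (CharP.charP_iff_prime_eq_zero hp).2 ?_
    rw [← map_natCast (IsLocalRing.residue V), IsLocalRing.residue_eq_zero_iff,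
      ← ValuationSubring.coe_mem_nonunits_iff]
    exact_mod_cast hV
  have hmap : ∀ (S : Type u) [CommRing S] (φ : V →+* S),
      map φ (map (Int.castRingHom V) f) = map (Int.castRingHom S) f := fun S _ φ => by
    rw [map_map, RingHom.eq_intCast' (φ.comp _)]
  have hres : Irreducible (map (IsLocalRing.residue V) (map (Int.castRingHom V) f)) := by
    rw [hmap]
    exact hirr _
  have hfV := hf.map (Int.castRingHom V)
  have hfV0 : map (Int.castRingHom V) f ≠ 0 := fun h => hres.ne_zero (by rw [h, map_zero])
  rw [← hmap K (algebraMap V K)]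
  refine irreducible_map_of_irreducible_residue hres ?_
  rw [hfV.totalDegree hfV0, (hfV.map _).totalDegree hres.ne_zero]

end Reduction

section EvenPerturbation

/-- An integral form with set of exponents `S`, all of whose coefficients are even apart from those
at two chosen exponents `m₁, m₂ ∈ S`, which are `3` and `-1`. Modulo `2` it is the sum of the
monomials `m₁` and `m₂`; the sign of the coefficient at `m₂` makes it indefinite. -/
noncomputable def evenPerturbation {σ : Type*} (S : Finset (σ →₀ ℕ)) (m₁ m₂ : σ →₀ ℕ) :
    MvPolynomial σ ℤ :=
  monomial m₁ 1 + monomial m₂ 1 + 2 * (∑ m ∈ S, monomial m 1 - 2 * monomial m₂ 1)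

variable {σ : Type*} {S : Finset (σ →₀ ℕ)} {m₁ m₂ : σ →₀ ℕ}

lemma isHomogeneous_evenPerturbation {d : ℕ} (hS : ∀ m ∈ S, m.degree = d) (h₁ : m₁ ∈ S)
    (h₂ : m₂ ∈ S) : (evenPerturbation S m₁ m₂).IsHomogeneous d := by
  have hmon : ∀ m ∈ S, (monomial m (1 : ℤ)).IsHomogeneous d := fun m hm =>
    isHomogeneous_monomial 1 (hS m hm)
  have htwo : ∀ {p : MvPolynomial σ ℤ}, p.IsHomogeneous d → (2 * p).IsHomogeneous d := fun hp => by
    simpa using hp.C_mul 2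
  exact ((hmon m₁ h₁).add (hmon m₂ h₂)).add
    (htwo ((IsHomogeneous.sum S _ d hmon).sub (htwo (hmon m₂ h₂))))

lemma coeff_evenPerturbation [DecidableEq σ] (i : σ →₀ ℕ) :
    coeff i (evenPerturbation S m₁ m₂) =
      (if m₁ = i then 1 else 0) + (if m₂ = i then 1 else 0) +
        2 * ((if i ∈ S then 1 else 0) - 2 * if m₂ = i then 1 else 0) := by
  have htwo : (2 : MvPolynomial σ ℤ) = C 2 := rfl
  rw [evenPerturbation, htwo]
  simp only [coeff_add, coeff_sub, coeff_C_mul, coeff_sum, coeff_monomial,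
    Finset.sum_ite_eq']

lemma support_evenPerturbation (h₁ : m₁ ∈ S) (h₂ : m₂ ∈ S) (hne : m₁ ≠ m₂) :
    (evenPerturbation S m₁ m₂).support = S := by
  classical
  ext i
  rw [mem_support_iff, coeff_evenPerturbation]
  by_cases hi : i ∈ S
  · simp only [hi, if_true, iff_true]
    split_ifs with hi₁ hi₂
    · exact absurd (hi₁.trans hi₂.symm) hne
    all_goals norm_num
  · simp [hi, ne_of_mem_of_not_mem h₁ hi, ne_of_mem_of_not_mem h₂ hi]

lemma map_evenPerturbation_of_charP_two {R : Type*} [CommRing R] [CharP R 2] :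
    map (Int.castRingHom R) (evenPerturbation S m₁ m₂) = monomial m₁ 1 + monomial m₂ 1 := by
  simp [evenPerturbation, CharTwo.two_eq_zero]

lemma eval_one_map_evenPerturbation {R : Type*} [CommRing R] :
    eval 1 (map (Int.castRingHom R) (evenPerturbation S m₁ m₂)) = 2 * (S.card : R) - 2 := by
  simp only [evenPerturbation, map_add, map_sub, map_mul, map_sum, map_ofNat, map_monomial,
    map_one, eval_monomial, Finsupp.prod, Pi.one_apply, one_pow, Finset.prod_const_one, mul_one,
    Finset.sum_const, nsmul_eq_mul]
  ring

lemma coeff_right_evenPerturbation (h₂ : m₂ ∈ S) (hne : m₁ ≠ m₂) :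
    coeff m₂ (evenPerturbation S m₁ m₂) = -1 := by
  classical
  simp [coeff_evenPerturbation, h₂, hne]

lemma eval_single_of_isHomogeneous {σ R : Type*} [CommSemiring R] [DecidableEq σ]
    {p : MvPolynomial σ R} {d : ℕ} (hp : p.IsHomogeneous d) (i : σ) :
    eval (Pi.single i 1) p = coeff (Finsupp.single i d) p := by
  have hvanish : ∀ m ∈ p.support, m ≠ Finsupp.single i d →
      coeff m p * ∏ j ∈ m.support, (Pi.single i 1 : σ → R) j ^ m j = 0 := by
    intro m hm hne
    obtain ⟨j, hj, hji⟩ : ∃ j ∈ m.support, j ≠ i := by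
      by_contra! hsupp
      obtain ⟨e, rfl⟩ := (Finsupp.support_subset_singleton' (a := i)).1 fun j hj => by
        simpa using hsupp j hj
      have hdeg := hp.degree_eq_sum_deg_support hm
      exact hne (by rw [hdeg, ← Finsupp.degree_apply, Finsupp.degree_single])
    rw [Finset.prod_eq_zero hj, mul_zero]
    rw [Pi.single_eq_of_ne hji, zero_pow (Finsupp.mem_support_iff.1 hj)]
  rw [eval_eq, Finset.sum_eq_single _ hvanish]
  · rw [Finset.prod_eq_one, mul_one]
    intro j hj
    rw [Finset.mem_singleton.1 (Finsupp.support_single_subset hj), Pi.single_eq_same, one_pow]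
  · exact fun hd => by rw [notMem_support_iff.1 hd, zero_mul]

lemma indefinite_map_evenPerturbation {n d : ℕ} {S : Finset (Fin n →₀ ℕ)} {m : Fin n →₀ ℕ}
    {i : Fin n} (hS : ∀ m ∈ S, m.degree = d) (hm : m ∈ S) (hi : Finsupp.single i d ∈ S)
    (hne : m ≠ Finsupp.single i d) :
    Indefinite (map (Int.castRingHom ℝ) (evenPerturbation S m (Finsupp.single i d))) := by
  refine ⟨⟨1, ?_⟩, Pi.single i 1, ?_⟩
  · have hcard : (1 : ℝ) < S.card := by
      exact_mod_cast Finset.one_lt_card.2 ⟨m, hm, _, hi, hne⟩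
    rw [eval_one_map_evenPerturbation]
    linarith
  · rw [eval_single_of_isHomogeneous ((isHomogeneous_evenPerturbation hS hm hi).map _), coeff_map,
      coeff_right_evenPerturbation hi hne]
    norm_num

end EvenPerturbation

section Existence

lemma irreducible_monomial_add_monomial {σ R : Type*} [CommRing R] [IsDomain R]
    [UniqueFactorizationMonoid R] {i₀ i₁ i₂ : σ} (h01 : i₀ ≠ i₁) (h02 : i₀ ≠ i₂) (h12 : i₁ ≠ i₂)
    (a b : ℕ) :
    Irreducible (monomial (Finsupp.single i₀ a + Finsupp.single i₁ 1) 1 +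
      monomial (Finsupp.single i₂ b) 1 : MvPolynomial σ R) := by
  classical
  have hX : (monomial (Finsupp.single i₀ a + Finsupp.single i₁ 1) 1 +
      monomial (Finsupp.single i₂ b) 1 : MvPolynomial σ R) = X i₀ ^ a * X i₁ + X i₂ ^ b := by
    rw [← mul_one (1 : R), ← monomial_mul, mul_one, X_pow_eq_monomial, X_pow_eq_monomial, X]
  have hrel : IsRelPrime (X i₀ ^ a : MvPolynomial σ R) (X i₂ ^ b) := by
    refine IsRelPrime.pow ((X_prime (i := i₀)).irreducible.isRelPrime_iff_not_dvd.2 fun h => ?_)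
    exact h02 (X_dvd_X.1 h)
  have hvars : ∀ {i : σ} (e : ℕ), i ≠ i₁ → i₁ ∉ (X i ^ e : MvPolynomial σ R).vars := by
    intro i e hi hmem
    simpa [vars_X, hi.symm] using vars_pow _ _ hmem
  rw [hX]
  exact irreducible_mul_X_add _ _ i₁ (pow_ne_zero a (X_ne_zero i₀)) (hvars a h01)
    (hvars b h12.symm) hrel

lemma mem_finsuppAntidiag_univ_iff {n d : ℕ} {m : Fin n →₀ ℕ} :
    m ∈ (Finset.univ : Finset (Fin n)).finsuppAntidiag d ↔ m.degree = d := by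
  simp [Finset.mem_finsuppAntidiag, Finsupp.degree_eq_sum]

lemma card_finsuppAntidiag_univ {n : ℕ} (hn : n ≠ 0) (d : ℕ) :
    ((Finset.univ : Finset (Fin n)).finsuppAntidiag d).card = N n d := by
  rw [Finset.card_finsuppAntidiag_nat_eq_choose, Finset.card_univ, Fintype.card_fin, N]
  exact Nat.choose_symm_of_eq_add (by omega)

lemma exists_superset_degree_eq {n d k : ℕ} {T : Finset (Fin n →₀ ℕ)} (hn : n ≠ 0)
    (hT : ∀ m ∈ T, m.degree = d) (hTk : T.card ≤ k) (hkN : k ≤ N n d) :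
    ∃ S : Finset (Fin n →₀ ℕ), T ⊆ S ∧ (∀ m ∈ S, m.degree = d) ∧ S.card = k := by
  obtain ⟨S, hTS, hS, hcard⟩ := Finset.exists_subsuperset_card_eq
    (fun m hm => mem_finsuppAntidiag_univ_iff.2 (hT m hm)) hTk
    (hkN.trans_eq (card_finsuppAntidiag_univ hn d).symm)
  exact ⟨S, hTS, fun m hm => mem_finsuppAntidiag_univ_iff.1 (hS hm), hcard⟩

theorem exists_indefinite_irreducible {n d k : ℕ} (hn : 3 ≤ n) (hd : d ≠ 0) (hk : 2 ≤ k)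
    (hkN : k ≤ N n d) :
    ∃ h ∈ F n d, h.support.card = k ∧ Indefinite h ∧ Irreducible h := by
  let i₀ : Fin n := ⟨0, by omega⟩
  let i₁ : Fin n := ⟨1, by omega⟩
  let i₂ : Fin n := ⟨2, by omega⟩
  have h01 : i₀ ≠ i₁ := by simp [i₀, i₁]
  have h02 : i₀ ≠ i₂ := by simp [i₀, i₂]
  have h12 : i₁ ≠ i₂ := by simp [i₁, i₂]
  let m₁ : Fin n →₀ ℕ := Finsupp.single i₀ (d - 1) + Finsupp.single i₁ 1
  let m₂ : Fin n →₀ ℕ := Finsupp.single i₂ d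
  have hne : m₁ ≠ m₂ := fun h => by
    simpa [m₁, m₂, h01, h12.symm] using DFunLike.congr_fun h i₁
  have hdeg : ∀ m ∈ ({m₁, m₂} : Finset (Fin n →₀ ℕ)), m.degree = d := by
    intro m hm
    rcases Finset.mem_insert.1 hm with rfl | hm
    · rw [map_add, Finsupp.degree_single, Finsupp.degree_single]
      omega
    · rw [Finset.mem_singleton.1 hm, Finsupp.degree_single]
  obtain ⟨S, hsub, hS, rfl⟩ :=
    exists_superset_degree_eq (by omega) hdeg ((Finset.card_pair hne).trans_le hk) hkN
  have h₁ : m₁ ∈ S := hsub (by simp)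
  have h₂ : m₂ ∈ S := hsub (by simp)
  let f := evenPerturbation S m₁ m₂
  have hf : f.IsHomogeneous d := isHomogeneous_evenPerturbation hS h₁ h₂
  refine ⟨map (Int.castRingHom ℝ) f, hf.map _, ?_,
    indefinite_map_evenPerturbation hS h₁ h₂ hne, irreducible_map_intCast Nat.prime_two hf ?_⟩
  · rw [support_map_of_injective _ Int.cast_injective, support_evenPerturbation h₁ h₂ hne]
  · intro K _ _
    rw [map_evenPerturbation_of_charP_two]
    exact irreducible_monomial_add_monomial h01 h02 h12 _ _

lemma isProductOfLinearForms_pow_mul_pow {n : ℕ} {p q : MvPolynomial (Fin n) ℝ} (hp : p ∈ F n 1)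
    (hq : q ∈ F n 1) (a b : ℕ) : IsProductOfLinearForms (p ^ a * q ^ b) := by
  refine ⟨a + b, Fin.append (fun _ => p) fun _ => q, fun i => ?_, by simp [Fin.prod_univ_add]⟩
  refine Fin.addCases (fun i => ?_) (fun i => ?_) i
  · simpa using hp
  · simpa using hq

lemma X_pow_mul_X_add_X_pow {σ R : Type*} [CommSemiring R] (i j : σ) (a b : ℕ) :
    (X i ^ a * (X i + X j) ^ b : MvPolynomial σ R) =
      ∑ e ∈ Finset.range (b + 1),
        monomial (Finsupp.single i (a + e) + Finsupp.single j (b - e)) (b.choose e : R) := by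
  rw [add_pow, Finset.mul_sum]
  refine Finset.sum_congr rfl fun e _ => ?_
  rw [monomial_single_add, ← C_mul_X_pow_eq_monomial, pow_add, map_natCast]
  ring

lemma support_sum_monomial {ι σ R : Type*} [CommSemiring R] {s : Finset ι} {m : ι → σ →₀ ℕ}
    (hm : Function.Injective m) {c : ι → R} (hc : ∀ e ∈ s, c e ≠ 0) :
    (∑ e ∈ s, monomial (m e) (c e)).support = s.map ⟨m, hm⟩ := by
  classical
  ext i
  rw [mem_support_iff, coeff_sum, Finset.mem_map]
  simp only [coeff_monomial, Function.Embedding.coeFn_mk]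
  refine ⟨fun h => ?_, ?_⟩
  · obtain ⟨e, he, hei⟩ := Finset.exists_ne_zero_of_sum_ne_zero h
    exact ⟨e, he, (ite_ne_right_iff.1 hei).1⟩
  · rintro ⟨e, he, rfl⟩
    simpa [hm.eq_iff, he] using hc e he

lemma card_support_X_pow_mul_X_add_X_pow {σ R : Type*} [CommSemiring R] [CharZero R] {i j : σ}
    (hij : i ≠ j) (a b : ℕ) :
    (X i ^ a * (X i + X j) ^ b : MvPolynomial σ R).support.card = b + 1 := by
  let m : ℕ → σ →₀ ℕ := fun e => Finsupp.single i (a + e) + Finsupp.single j (b - e)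
  have hm : Function.Injective m := fun e e' h => by
    simpa [m, hij.symm] using DFunLike.congr_fun h i
  have hchoose : ∀ e ∈ Finset.range (b + 1), (b.choose e : R) ≠ 0 := fun e he =>
    Nat.cast_ne_zero.2 (Nat.choose_pos (Finset.mem_range_succ_iff.1 he)).ne'
  rw [X_pow_mul_X_add_X_pow, support_sum_monomial hm hchoose, Finset.card_map, Finset.card_range]

theorem exists_isProductOfLinearForms {d k : ℕ} (hk : k ≠ 0) (hkd : k ≤ d + 1) :
    ∃ h ∈ F 2 d, h.support.card = k ∧ IsProductOfLinearForms h := by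
  have hX : ∀ i : Fin 2, (X i : MvPolynomial (Fin 2) ℝ) ∈ F 2 1 := isHomogeneous_X ℝ
  have hadd : (X 0 + X 1 : MvPolynomial (Fin 2) ℝ) ∈ F 2 1 := add_mem (hX 0) (hX 1)
  obtain ⟨a, b, rfl, rfl⟩ : ∃ a b, d = a + b ∧ k = b + 1 :=
    ⟨d + 1 - k, k - 1, by omega, by omega⟩
  have hhom := (IsHomogeneous.pow (hX 0) a).mul (IsHomogeneous.pow hadd b)
  rw [one_mul, one_mul] at hhom
  exact ⟨X 0 ^ a * (X 0 + X 1) ^ b, hhom, card_support_X_pow_mul_X_add_X_pow zero_ne_one a b,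
    isProductOfLinearForms_pow_mul_pow (hX 0) hadd a b⟩

lemma two_le_and_ne_zero_of_two_le_N {n d : ℕ} (h : 2 ≤ N n d) : 2 ≤ n ∧ d ≠ 0 := by
  refine ⟨?_, ?_⟩
  · by_contra! hn
    have hn0 : n - 1 = 0 := by omega
    simp [N, hn0] at h
  · rintro rfl
    simp [N] at h

lemma N_two (d : ℕ) : N 2 d = d + 1 := by
  rw [N, Nat.choose_one_right]
  omega

theorem exists_form_card_support_eq {n d k : ℕ} (hk : 2 ≤ k) (hkN : k ≤ N n d) :
    ∃ h ∈ F n d, h.support.card = k ∧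
      ((n = 2 ∧ IsProductOfLinearForms h) ∨ (3 ≤ n ∧ Indefinite h ∧ Irreducible h)) := by
  obtain ⟨hn, hd⟩ := two_le_and_ne_zero_of_two_le_N (hk.trans hkN)
  obtain rfl | hn := hn.eq_or_lt
  · obtain ⟨h, hh, hcard, hl⟩ :=
      exists_isProductOfLinearForms (by omega) (hkN.trans_eq (N_two d))
    exact ⟨h, hh, hcard, .inl ⟨rfl, hl⟩⟩
  · obtain ⟨h, hh, hcard, hind⟩ := exists_indefinite_irreducible hn hd hk hkN
    exact ⟨h, hh, hcard, .inr ⟨hn, hind⟩⟩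

end Existence

end SosTerms

theorem theorem1p2 (n d k : ℕ) (hk : 2 ≤ k) (hkN : k ≤ SosTerms.N n d) :
    SosTerms.Sigma n d (k - 1) ⊂ SosTerms.Sigma n d k ∧
    (∀ h ∈ SosTerms.F n d, h.support.card = k →
      ((SosTerms.Indefinite h ∧ Irreducible h) ∨ SosTerms.IsProductOfLinearForms h) →
      h ^ 2 ∈ SosTerms.Sigma n d k \ SosTerms.Sigma n d (k - 1)) ∧
    (∃ h ∈ SosTerms.F n d, h.support.card = k ∧
      ((n = 2 ∧ SosTerms.IsProductOfLinearForms h) ∨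
        (3 ≤ n ∧ SosTerms.Indefinite h ∧ Irreducible h))) := by
  have hk0 : k ≠ 0 := by omega
  obtain ⟨h, hh, hcard, hcase⟩ := SosTerms.exists_form_card_support_eq hk hkN
  obtain ⟨hmem, hnotMem⟩ := SosTerms.sq_mem_sigma_diff hk0 hh hcard
    (hcase.elim (fun hlin => .inr hlin.2) fun hind => .inl hind.2)
  exact ⟨⟨SosTerms.sigma_mono (Nat.sub_le k 1), fun hsub => hnotMem (hsub hmem)⟩,
    fun _ => SosTerms.sq_mem_sigma_diff hk0, h, hh, hcard, hcase⟩
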